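/- Let $P(M,G)$ be a smooth principal $G$-bundle (finite-dimensional manifolds), with right action $\kappa(p,g)=pg$, $\kappa_p:=\kappa(p,\cdot)$, $\kappa_g:=\kappa(\cdot,g)$, projection $\mu:P\to M$, and cotangent projection $\pi^*:T^*P\to P$. Let $Conn\,P(M,G)$ be the set of connection forms, i.e. smooth $T_eG$-valued one-forms $\alpha$ on $P$ with $\alpha_p\circ T\kappa_p(e)=\mathrm{id}$ and $\alpha_{pg}\circ T\kappa_g(p)=Ad_{g^{-1}}\circ\alpha_p$. Let $Can\,T^*P$ be the set of smooth one-forms $\gamma$ on $T^*P$ such that (i) $\gamma_\varphi\neq0$ for every nonzero $\varphi\in T^*P$, (ii) $\ker T\pi^*(\varphi)\subset\ker\gamma_\varphi$ for all $\varphi$, and (iii) $\langle\gamma,\xi\rangle$ is a smooth fibrewise linear function for every linear vector field $\xi$ on $T^*P$ (a smooth vector field on $T^*P$ which is a morphism of vector bundles from $T^*P\to P$ to $T(T^*P)\to TP$ over a smooth vector field $\chi$ on $P$). Let $Aut_0TP$ be the group of smooth vector bundle automorphisms $A$ of $TP$ covering $\mathrm{id}_P$; let $Aut_{TG}TP\subset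 Aut_0TP$ consist of those commuting with the maps $v_p\mapsto T\kappa_g(p)\,(v_p+T\kappa_p(e)X)$ for all $g\in G$, $X\in T_eG$; and let $Aut_NTP\subset Aut_{TG}TP$ consist of those $A=\mathrm{id}_{TP}+B$ for which $B(p)$ has values in $\ker T\mu(p)$ for every $p$. For $A\in Aut_0TP$ put $\Theta(A)_\varphi:=\varphi\circ A(\pi^*(\varphi))\circ T\pi^*(\varphi)$ and $A^*(\varphi):=\varphi\circ A(\pi^*(\varphi))$, and put $Can_{TG}T^*P:=\Theta(Aut_{TG}TP)$. Let $\gamma_0=\Theta(\mathrm{id}_{TP})$ be the canonical one-form and $\omega_0=d\gamma_0$. Fix a connection $\alpha\in Conn\,P(M,G)$. Then $$\iota_\alpha(\alpha')_\varphi:=\varphi\circ T\pi^*(\varphi)+\varphi\circ T\kappa_{\pi^*(\varphi)}(e)\circ(\alpha'_{\pi^*(\varphi)}-\alpha_{\pi^*(\varphi)})\circ T\pi^*(\varphi)$$ defines an embedding (injective map) of $Conn\,P(M,G)$ into $Can_{TG}T^*P$, and its values lie in $Can\,T^*P$. For every $\alpha'\in Conn\,P(M,G)$, with $B(p):=T\kappa_p(e)\circ(\alpha'_p-\alpha_p)$,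 one has $\mathrm{id}_{TP}+B\in Aut_NTP$, the bundle map $(\mathrm{id}_{TP}+B)^*:T^*P\to T^*P$ is smooth, the form $d\iota_\alpha(\alpha')$ is symplectic, and $d\iota_\alpha(\alpha')$ is the pullback of $\omega_0$ by $(\mathrm{id}_{TP}+B)^*$. -/

import Mathlib

open Bundle Set
open scoped Manifold ContDiff Bundle

noncomputable section

namespace GenCanon

/-! ### Differential forms on manifolds -/

section Forms

variable {E : Type*} [NormedAddCommGroup E] [NormedSpace ℝ E]
  {H : Type*} [TopologicalSpace H] (I : ModelWithCorners ℝ E H)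
  (N : Type*) [TopologicalSpace N] [ChartedSpace H N]

/-- A (not necessarily smooth) real differential form of degree `n` on `N`. -/
abbrev DiffForm (n : ℕ) : Type _ := (x : N) → TangentSpace I x [⋀^Fin n]→L[ℝ] ℝ

/-- A (not necessarily smooth) one-form on `N`: a covector at every point. -/
abbrev OneForm : Type _ := (x : N) → TangentSpace I x →L[ℝ] ℝ

/-- The total space of the cotangent bundle `T*N`. Its points are `φ = ⟨p, φ.2⟩` with
`p = φ.1 = π*(φ)` and `φ.2` a covector at `p`. -/
abbrev Cotangent : Type _ := TotalSpace (E →L[ℝ] ℝ) (fun x : N => TangentSpace I x →L[ℝ] ℝ)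

/-- The model with corners of the manifold `T*N`. -/
abbrev cotModel : ModelWithCorners ℝ (E × (E →L[ℝ] ℝ)) (ModelProd H (E →L[ℝ] ℝ)) :=
  I.prod 𝓘(ℝ, E →L[ℝ] ℝ)

variable {I N}

/-- A one-form regarded as a differential form of degree one. -/
def toForm (θ : OneForm I N) : DiffForm I N 1 := fun x =>
  ContinuousAlternatingMap.ofSubsingleton ℝ (TangentSpace I x) ℝ (0 : Fin 1) (θ x)

/-- The expression of a differential form in the chart at `x₀`: its pullback by the inverse of
the chart. -/
def inChart {n : ℕ} (σ : DiffForm I N n) (x₀ : N) : E → E [⋀^Fin n]→L[ℝ] ℝ := fun y =>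
  (σ ((extChartAt I x₀).symm y)).compContinuousLinearMap
    (mfderivWithin 𝓘(ℝ, E) I (extChartAt I x₀).symm (range I) y)

/-- A differential form is smooth if its expressions in all preferred charts are smooth. -/
def IsSmoothForm {n : ℕ} (σ : DiffForm I N n) : Prop :=
  ∀ x₀ : N, ContDiffOn ℝ ∞ (inChart σ x₀) (extChartAt I x₀).target

/-- The exterior derivative, computed at each point `x` in the chart at `x`. -/
def extD {n : ℕ} (σ : DiffForm I N n) : DiffForm I N (n + 1) := fun x =>
  (extDerivWithin (inChart σ x) (range I) (extChartAt I x x)).compContinuousLinearMap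
    (mfderiv I 𝓘(ℝ, E) (extChartAt I x) x)

/-- The pullback of a differential form by a map. -/
def pullback {E' : Type*} [NormedAddCommGroup E'] [NormedSpace ℝ E']
    {H' : Type*} [TopologicalSpace H'] {I' : ModelWithCorners ℝ E' H'}
    {N' : Type*} [TopologicalSpace N'] [ChartedSpace H' N']
    {n : ℕ} (σ : DiffForm I' N' n) (f : N → N') : DiffForm I N n := fun x =>
  (σ (f x)).compContinuousLinearMap (mfderiv I I' f x)

/-- A symplectic form: a smooth, closed, nondegenerate two-form. -/
structure IsSymplectic (σ : DiffForm I N 2) : Prop where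
  smooth : IsSmoothForm σ
  closed : extD σ = 0
  nondegenerate : ∀ (x : N) (v : TangentSpace I x),
    (∀ w : TangentSpace I x, σ x ![v, w] = 0) → v = 0

/-- A one-form is smooth if it is a smooth section of the cotangent bundle. -/
def IsSmoothOneForm [IsManifold I ∞ N] (θ : OneForm I N) : Prop :=
  ContMDiff I (cotModel I) ∞ (fun x => (⟨x, θ x⟩ : Cotangent I N))

end Forms

/-! ### The cotangent bundle and generalized canonical forms -/

section Canonical

variable {E : Type*} [NormedAddCommGroup E] [NormedSpace ℝ E]
  {P : Type*} [TopologicalSpace P] [ChartedSpace E P] [IsManifold 𝓘(ℝ, E) ∞ P]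

variable (E P) in
/-- The cotangent bundle `T*P`. -/
abbrev TStar : Type _ := Cotangent 𝓘(ℝ, E) P

variable (E) in
/-- The model with corners of `T*P`. -/
abbrev JJ : ModelWithCorners ℝ (E × (E →L[ℝ] ℝ)) (ModelProd E (E →L[ℝ] ℝ)) := cotModel 𝓘(ℝ, E)

/-- The tangent map `Tπ*(φ) : T_φ(T*P) → T_pP`, `p = π*(φ)`, of the projection `π* : T*P → P`. -/
def dproj (φ : TStar E P) : TangentSpace (JJ E) φ →L[ℝ] TangentSpace 𝓘(ℝ, E) φ.1 :=
  mfderiv (JJ E) 𝓘(ℝ, E) (fun ψ : TStar E P => ψ.1) φ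

variable (E P) in
/-- The canonical one-form `γ₀` on `T*P`. -/
def canonicalForm : OneForm (JJ E) (TStar E P) := fun φ => φ.2 ∘L dproj φ

variable (E P) in
/-- The Whitney sum `T*P ⊕ T*P` over `P`. -/
abbrev TStar₂ : Type _ :=
  TotalSpace ((E →L[ℝ] ℝ) × (E →L[ℝ] ℝ))
    ((fun p : P => TangentSpace 𝓘(ℝ, E) p →L[ℝ] ℝ) ×ᵇ
      (fun p : P => TangentSpace 𝓘(ℝ, E) p →L[ℝ] ℝ))

variable (E) in
/-- The model with corners of `T*P ⊕ T*P`. -/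
abbrev JJ₂ : ModelWithCorners ℝ (E × ((E →L[ℝ] ℝ) × (E →L[ℝ] ℝ)))
    (ModelProd E ((E →L[ℝ] ℝ) × (E →L[ℝ] ℝ))) :=
  𝓘(ℝ, E).prod 𝓘(ℝ, (E →L[ℝ] ℝ) × (E →L[ℝ] ℝ))

/-- The first projection `T*P ⊕ T*P → T*P`. -/
def whitneyFst (z : TStar₂ E P) : TStar E P := ⟨z.1, z.2.1⟩

/-- The second projection `T*P ⊕ T*P → T*P`. -/
def whitneySnd (z : TStar₂ E P) : TStar E P := ⟨z.1, z.2.2⟩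

/-- Fibrewise addition `T*P ⊕ T*P → T*P`. -/
def whitneyAdd (z : TStar₂ E P) : TStar E P := ⟨z.1, z.2.1 + z.2.2⟩

/-- Fibrewise multiplication by the real number `r`. -/
def fibreSMul (r : ℝ) (φ : TStar E P) : TStar E P := ⟨φ.1, r • φ.2⟩

/-- `(ξ, χ)` is a linear vector field on `T*P`: `ξ` and `χ` are smooth vector fields on `T*P` and
`P`, and `ξ : T*P → T(T*P)` is a morphism of vector bundles over `χ : P → TP`. Here the vector
bundle structure of `T(T*P) → TP` (with projection `Tπ*`) is the tangent prolongation of that of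
`T*P → P`: its addition and its scalar multiplications are the tangent maps of those of `T*P`. -/
structure IsLinearVectorField (ξ : (φ : TStar E P) → TangentSpace (JJ E) φ)
    (χ : (p : P) → TangentSpace 𝓘(ℝ, E) p) : Prop where
  smooth_total : ContMDiff (JJ E) (JJ E).tangent ∞
    (fun φ => (⟨φ, ξ φ⟩ : TangentBundle (JJ E) (TStar E P)))
  smooth_base : ContMDiff 𝓘(ℝ, E) 𝓘(ℝ, E).tangent ∞
    (fun p => (⟨p, χ p⟩ : TangentBundle 𝓘(ℝ, E) P))
  projects : ∀ φ, dproj φ (ξ φ) = χ φ.1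
  additive : ∀ (z : TStar₂ E P) (ζ : TangentSpace (JJ₂ E) z),
    mfderiv (JJ₂ E) (JJ E) whitneyFst z ζ = ξ (whitneyFst z) →
    mfderiv (JJ₂ E) (JJ E) whitneySnd z ζ = ξ (whitneySnd z) →
    mfderiv (JJ₂ E) (JJ E) whitneyAdd z ζ = ξ (whitneyAdd z)
  homogeneous : ∀ (r : ℝ) (φ : TStar E P),
    mfderiv (JJ E) (JJ E) (fibreSMul r) φ (ξ φ) = ξ (fibreSMul r φ)

/-- `l` is a smooth fibrewise linear function on `T*P`. -/
structure IsLinearFunction (l : TStar E P → ℝ) : Prop where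
  smooth : ContMDiff (JJ E) 𝓘(ℝ) ∞ l
  linear : ∀ p : P, IsLinearMap ℝ
    (fun η : TangentSpace 𝓘(ℝ, E) p →L[ℝ] ℝ => l (⟨p, η⟩ : TStar E P))

variable (E P) in
/-- The set `Can T*P` of generalized canonical forms on `T*P`: the smooth one-forms `γ` on `T*P`
such that `γ_φ ≠ 0` off the zero section, `ker Tπ*(φ) ⊆ ker γ_φ`, and `⟨γ, ξ⟩` is a smooth
fibrewise linear function for every linear vector field `ξ`. -/
def Can : Set (OneForm (JJ E) (TStar E P)) :=
  {γ | IsSmoothOneForm γ ∧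
    (∀ φ : TStar E P, φ.2 ≠ 0 → γ φ ≠ 0) ∧
    (∀ (φ : TStar E P) (v : TangentSpace (JJ E) φ), dproj φ v = 0 → γ φ v = 0) ∧
    (∀ ξ χ, IsLinearVectorField ξ χ → IsLinearFunction (fun φ : TStar E P => γ φ (ξ φ)))}

variable (E P) in
/-- A family of endomorphisms of the tangent spaces of `P`. -/
abbrev TangentEndo : Type _ :=
  (p : P) → TangentSpace 𝓘(ℝ, E) p →L[ℝ] TangentSpace 𝓘(ℝ, E) p

/-- `A ∈ Aut₀ TP`: `A` is a smooth automorphism of `TP` covering the identity of `P`. -/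
structure IsAut₀ (A : TangentEndo E P) : Prop where
  smooth : ContMDiff 𝓘(ℝ, E) (𝓘(ℝ, E).prod 𝓘(ℝ, E →L[ℝ] E)) ∞
    (fun p => (⟨p, A p⟩ : TotalSpace (E →L[ℝ] E)
      (fun p : P => TangentSpace 𝓘(ℝ, E) p →L[ℝ] TangentSpace 𝓘(ℝ, E) p)))
  bijective : ∀ p, Function.Bijective (A p)

/-- The one-form `Θ(A)` on `T*P`. -/
def Theta (A : TangentEndo E P) : OneForm (JJ E) (TStar E P) := fun φ =>
  φ.2 ∘L A φ.1 ∘L dproj φ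

/-- The dual bundle map `A* : T*P → T*P`, `A*(φ) = φ ∘ A(π*(φ))`. -/
def dual (A : TangentEndo E P) (φ : TStar E P) : TStar E P := ⟨φ.1, φ.2 ∘L A φ.1⟩

end Canonical

/-! ### Principal bundles and connections -/

section Principal

variable (EP EM EG : Type*) [NormedAddCommGroup EP] [NormedSpace ℝ EP]
  [NormedAddCommGroup EM] [NormedSpace ℝ EM] [NormedAddCommGroup EG] [NormedSpace ℝ EG]
  (P M G : Type*)
  [TopologicalSpace P] [ChartedSpace EP P] [IsManifold 𝓘(ℝ, EP) ∞ P]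
  [TopologicalSpace M] [ChartedSpace EM M] [IsManifold 𝓘(ℝ, EM) ∞ M]
  [TopologicalSpace G] [ChartedSpace EG G] [Group G] [LieGroup 𝓘(ℝ, EG) ∞ G]

/-- A smooth principal `G`-bundle `P(M, G)`: a smooth right action `κ` of `G` on `P` and a smooth
projection `μ : P → M` with smooth `G`-equivariant local trivializations `μ⁻¹(U) ≃ U × G`. -/
structure PrincipalBundle where
  /-- the right action `κ(p, g) = pg` -/
  κ : P → G → P
  /-- the bundle projection -/
  μ : P → M
  smooth_κ : ContMDiff (𝓘(ℝ, EP).prod 𝓘(ℝ, EG)) 𝓘(ℝ, EP) ∞ (fun z : P × G => κ z.1 z.2)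
  smooth_μ : ContMDiff 𝓘(ℝ, EP) 𝓘(ℝ, EM) ∞ μ
  act_one : ∀ p, κ p 1 = p
  act_mul : ∀ p g h, κ p (g * h) = κ (κ p g) h
  μ_act : ∀ p g, μ (κ p g) = μ p
  locally_trivial : ∀ m : M, ∃ (U : Set M) (e : OpenPartialHomeomorph P (M × G)),
    IsOpen U ∧ m ∈ U ∧ e.source = μ ⁻¹' U ∧ e.target = U ×ˢ univ ∧
    ContMDiffOn 𝓘(ℝ, EP) (𝓘(ℝ, EM).prod 𝓘(ℝ, EG)) ∞ e e.source ∧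
    ContMDiffOn (𝓘(ℝ, EM).prod 𝓘(ℝ, EG)) 𝓘(ℝ, EP) ∞ e.symm e.target ∧
    (∀ p ∈ e.source, (e p).1 = μ p) ∧
    (∀ p ∈ e.source, ∀ g, e (κ p g) = ((e p).1, (e p).2 * g))

variable {EP EM EG P M G}

namespace PrincipalBundle

variable (Q : PrincipalBundle EP EM EG P M G)

/-- The fundamental map `Tκ_p(e) : T_eG → T_pP`, where `κ_p(g) = pg`. The derivative has values in
the tangent space at `κ_p(e)`, and `κ_p(e) = p`. -/
def dorbit (p : P) : GroupLieAlgebra 𝓘(ℝ, EG) G →L[ℝ] TangentSpace 𝓘(ℝ, EP) p :=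
  (mfderiv 𝓘(ℝ, EG) 𝓘(ℝ, EP) (fun g : G => Q.κ p g) 1 : EG →L[ℝ] EP)

/-- The tangent map `Tκ_g(p) : T_pP → T_{pg}P`, where `κ_g(p) = pg`. -/
def dact (g : G) (p : P) : TangentSpace 𝓘(ℝ, EP) p →L[ℝ] TangentSpace 𝓘(ℝ, EP) (Q.κ p g) :=
  mfderiv 𝓘(ℝ, EP) 𝓘(ℝ, EP) (fun q : P => Q.κ q g) p

/-- The action `Φ_{(g, X)}(v) = Tκ_g(p)(v + Tκ_p(e) X)` of `TG ≅ G ⋉ T_eG` on `TP`. -/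
def Phi (g : G) (X : GroupLieAlgebra 𝓘(ℝ, EG) G) (p : P) (v : TangentSpace 𝓘(ℝ, EP) p) :
    TangentSpace 𝓘(ℝ, EP) (Q.κ p g) :=
  Q.dact g p (v + Q.dorbit p X)

/-- `A ∈ Aut_{TG} TP`: `A` is an element of `Aut₀ TP` that commutes with the action of `TG`. -/
structure IsAutTG (A : TangentEndo EP P) : Prop where
  isAut₀ : IsAut₀ A
  commutes : ∀ (g : G) (X : GroupLieAlgebra 𝓘(ℝ, EG) G) (p : P) (v : TangentSpace 𝓘(ℝ, EP) p),
    A (Q.κ p g) (Q.Phi g X p v) = Q.Phi g X p (A p v)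

/-- `A ∈ Aut_N TP`: `A` is an element of `Aut_{TG} TP` and `A(p) - id` has values in the vertical
space `ker Tμ(p)`. -/
structure IsAutN (A : TangentEndo EP P) : Prop where
  isAutTG : Q.IsAutTG A
  vertical : ∀ (p : P) (v : TangentSpace 𝓘(ℝ, EP) p),
    mfderiv 𝓘(ℝ, EP) 𝓘(ℝ, EM) Q.μ p (A p v - v) = 0

/-- The set `Can_{TG} T*P = Θ(Aut_{TG} TP)`. -/
def CanTG : Set (OneForm (JJ EP) (TStar EP P)) := {γ | ∃ A, Q.IsAutTG A ∧ γ = Theta A}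

end PrincipalBundle

/-- The adjoint representation `Ad_g : T_eG → T_eG`, the derivative of `h ↦ g h g⁻¹` at `e`
(which maps `e` to `e`). -/
def Ad (g : G) : GroupLieAlgebra 𝓘(ℝ, EG) G →L[ℝ] GroupLieAlgebra 𝓘(ℝ, EG) G :=
  (mfderiv 𝓘(ℝ, EG) 𝓘(ℝ, EG) (fun h : G => g * h * g⁻¹) 1 : EG →L[ℝ] EG)

/-- The space `Conn P(M, G)` of connection forms: smooth `T_eG`-valued one-forms `α` on `P` with
`α_p ∘ Tκ_p(e) = id` and `α_{pg} ∘ Tκ_g(p) = Ad_{g⁻¹} ∘ α_p`. -/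
structure Connection (Q : PrincipalBundle EP EM EG P M G) where
  /-- the value of the form at a point -/
  form : (p : P) → TangentSpace 𝓘(ℝ, EP) p →L[ℝ] GroupLieAlgebra 𝓘(ℝ, EG) G
  smooth : ContMDiff 𝓘(ℝ, EP) (𝓘(ℝ, EP).prod 𝓘(ℝ, EP →L[ℝ] EG)) ∞
    (fun p => (⟨p, form p⟩ : TotalSpace (EP →L[ℝ] EG)
      (fun p : P => TangentSpace 𝓘(ℝ, EP) p →L[ℝ] Trivial P EG p)))
  form_dorbit : ∀ (p : P) (X : GroupLieAlgebra 𝓘(ℝ, EG) G), form p (Q.dorbit p X) = X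
  form_dact : ∀ (p : P) (g : G) (v : TangentSpace 𝓘(ℝ, EP) p),
    form (Q.κ p g) (Q.dact g p v) = Ad g⁻¹ (form p v)

namespace Connection

variable {Q : PrincipalBundle EP EM EG P M G}

/-- The endomorphism `B(p) = Tκ_p(e) ∘ (α'_p - α_p)` of `T_pP`. -/
def B (α α' : Connection Q) : TangentEndo EP P := fun p =>
  Q.dorbit p ∘L (α'.form p - α.form p)

/-- The automorphism `id + B` of `TP`. -/
def idAddB (α α' : Connection Q) : TangentEndo EP P := fun p =>
  ContinuousLinearMap.id ℝ (TangentSpace 𝓘(ℝ, EP) p) + B α α' p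

/-- The one-form `ι_α(α')` on `T*P`, with value
`φ ∘ Tπ*(φ) + φ ∘ Tκ_p(e) ∘ (α'_p - α_p) ∘ Tπ*(φ)` at `φ`, where `p = π*(φ)`. -/
def iota (α α' : Connection Q) : OneForm (JJ EP) (TStar EP P) := fun φ =>
  φ.2 ∘L dproj φ + φ.2 ∘L Q.dorbit φ.1 ∘L (α'.form φ.1 - α.form φ.1) ∘L dproj φ

end Connection

end Principal

end GenCanon

end

/-! Write D for the fundamental map, so that B = D ∘ (α' - α). Since α' ∘ D = α ∘ D = id, the
difference α' - α kills vertical vectors, while B takes vertical values. Thus B² = 0. Exchanging α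
and α' replaces B by -B, so id - B, again built from two connections, inverts id + B
(`idAddB_comp_idAddB`). Equivariance of both connections makes id + B commute with the action of TG
(`isAutN_idAddB`).

The form ι_α(α') is Θ(id + B) (`iota_eq_Theta`), and the remaining claims, apart from injectivity,
hold for Θ(A) with A a general smooth automorphism over the identity. Membership in `Can` is
`Theta_mem_Can`. As A* covers the identity, Θ(A) is the pullback of γ₀ by A*
(`pullback_dual_canonicalForm`). Since d commutes with pullbacks (`extD_pullback`), dΘ(A) is the
pullback of ω₀. It is symplectic because ω₀ is and A* is a diffeomorphism with inverse (A⁻¹)*.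

For injectivity, Θ(A) determines A because Tπ* is onto and covectors separate vectors; id + B then
determines α', since α' is a left inverse of D. -/

noncomputable section

namespace GenCanon

/-! ### Smooth dependence of linear pullbacks of alternating forms. -/

section Alternating

variable {E F X : Type*} [NormedAddCommGroup E] [NormedSpace ℝ E]
  [NormedAddCommGroup F] [NormedSpace ℝ F] [NormedAddCommGroup X] [NormedSpace ℝ X]

variable (E) in
/-- Antisymmetrization of continuous multilinear forms as a continuous linear map. -/
def alternatizationCLM (n : ℕ) :
    ContinuousMultilinearMap ℝ (fun _ : Fin n => E) ℝ →L[ℝ] E [⋀^Fin n]→L[ℝ] ℝ where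
  toFun := ContinuousMultilinearMap.alternatization
  map_add' := map_add _
  map_smul' c f := by
    ext v
    simp [ContinuousMultilinearMap.alternatization_apply_apply, Finset.mul_sum, Units.smul_def,
      mul_left_comm]
  cont := by
    -- Alternating maps carry the topology induced from multilinear maps, where antisymmetrization
    -- is a finite signed sum of isometries permuting the arguments.
    rw [ContinuousAlternatingMap.isEmbedding_toContinuousMultilinearMap.continuous_iff]
    have h : (ContinuousAlternatingMap.toContinuousMultilinearMap ∘
        (ContinuousMultilinearMap.alternatization :
          ContinuousMultilinearMap ℝ (fun _ : Fin n => E) ℝ →+ E [⋀^Fin n]→L[ℝ] ℝ)) =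
        fun f => ∑ σ : Equiv.Perm (Fin n), (Equiv.Perm.sign σ : ℤ) •
          ContinuousMultilinearMap.domDomCongrₗᵢ ℝ E ℝ σ f := by
      ext f v
      simp [ContinuousMultilinearMap.alternatization_apply_apply, Units.smul_def,
        ContinuousMultilinearMap.domDomCongrₗᵢ, ContinuousMultilinearMap.domDomCongrEquiv,
        Function.comp_def]
    rw [h]
    refine continuous_finsetSum _ fun σ _ => ?_
    exact (ContinuousMultilinearMap.domDomCongrₗᵢ ℝ E ℝ σ).continuous.const_smul
      (Equiv.Perm.sign σ : ℤ)

lemma alternatizationCLM_coe {n : ℕ} (f : E [⋀^Fin n]→L[ℝ] ℝ) :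
    alternatizationCLM E n f.toContinuousMultilinearMap = (n.factorial : ℝ) • f := by
  ext v
  have h := DFunLike.congr_fun (AlternatingMap.coe_alternatization f.toAlternatingMap) v
  simpa [alternatizationCLM, ContinuousMultilinearMap.alternatization_apply_apply,
    MultilinearMap.alternatization_apply, Function.comp_def] using h

/-- For multilinear forms the pullback is linear in the form and multilinear in the copies of g,
hence smooth. Antisymmetrization divided by n! fixes alternating forms, so it carries this
smoothness back to the alternating space by a continuous linear map. -/
lemma _root_.ContDiffAt.compContinuousLinearMap_alternating {n : ℕ} {k : WithTop ℕ∞}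
    {f : X → F [⋀^Fin n]→L[ℝ] ℝ} {g : X → E →L[ℝ] F} {x : X}
    (hf : ContDiffAt ℝ k f x) (hg : ContDiffAt ℝ k g x) :
    ContDiffAt ℝ k (fun y => (f y).compContinuousLinearMap (g y)) x := by
  have h : (fun y => (f y).compContinuousLinearMap (g y)) = fun y =>
      ((n.factorial : ℝ)⁻¹) • alternatizationCLM E n
        (ContinuousMultilinearMap.compContinuousLinearMapContinuousMultilinear ℝ
          (fun _ : Fin n => E) (fun _ : Fin n => F) ℝ (fun _ => g y)
          (ContinuousAlternatingMap.toContinuousMultilinearMapCLM ℝ (f y))) := by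
    funext y
    have := alternatizationCLM_coe ((f y).compContinuousLinearMap (g y))
    rw [eq_inv_smul_iff₀ (by positivity), ← this]
    rfl
  rw [h]
  refine ((alternatizationCLM E n).contDiff.contDiffAt.comp x (ContDiffAt.clm_apply ?_ ?_)).const_smul _
  · exact (ContinuousMultilinearMap.contDiff _).contDiffAt.comp x (contDiffAt_pi.2 fun _ => hg)
  · exact (ContinuousLinearMap.contDiff _).contDiffAt.comp x hf

end Alternating

/-! ### Exterior calculus on manifolds, computed in charts. -/

section Charts

set_option linter.unusedSectionVars false

variable {E : Type*} [NormedAddCommGroup E] [NormedSpace ℝ E]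
  {H : Type*} [TopologicalSpace H] {I : ModelWithCorners ℝ E H} [I.Boundaryless]
  {N : Type*} [TopologicalSpace N] [ChartedSpace H N] [IsManifold I ∞ N]
  {E' : Type*} [NormedAddCommGroup E'] [NormedSpace ℝ E']
  {H' : Type*} [TopologicalSpace H'] {I' : ModelWithCorners ℝ E' H'} [I'.Boundaryless]
  {N' : Type*} [TopologicalSpace N'] [ChartedSpace H' N'] [IsManifold I' ∞ N']

lemma inChart_eq {n : ℕ} (σ : DiffForm I N n) (x₀ : N) (y : E) :
    inChart σ x₀ y = (σ ((extChartAt I x₀).symm y)).compContinuousLinearMap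
      (mfderiv 𝓘(ℝ, E) I (extChartAt I x₀).symm y) := by
  have h := mfderivWithin_univ (I := 𝓘(ℝ, E)) (I' := I) (f := (extChartAt I x₀).symm)
  rw [← I.range_eq_univ] at h
  rw [inChart, h]
  rfl

lemma extD_eq {n : ℕ} (σ : DiffForm I N n) (x : N) :
    extD σ x = (extDeriv (inChart σ x) (extChartAt I x x)).compContinuousLinearMap
      (mfderiv I 𝓘(ℝ, E) (extChartAt I x) x) := by
  rw [extD, I.range_eq_univ, extDerivWithin_univ]

lemma contMDiffAt_chart_symm {x₀ : N} {y : E} (hy : y ∈ (extChartAt I x₀).target) :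
    ContMDiffAt 𝓘(ℝ, E) I ∞ (extChartAt I x₀).symm y :=
  (contMDiffOn_extChartAt_symm x₀).contMDiffAt ((isOpen_extChartAt_target x₀).mem_nhds hy)

lemma contMDiffAt_chart {x₀ x : N} (hx : x ∈ (extChartAt I x₀).source) :
    ContMDiffAt I 𝓘(ℝ, E) ∞ (extChartAt I x₀) x :=
  contMDiffAt_extChartAt' (by rwa [extChartAt_source] at hx)

lemma mfderiv_chart_symm_comp {x₀ x : N} (hx : x ∈ (extChartAt I x₀).source) (v : E) :
    mfderiv 𝓘(ℝ, E) I (extChartAt I x₀).symm (extChartAt I x₀ x)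
      (mfderiv I 𝓘(ℝ, E) (extChartAt I x₀) x v) = v := by
  have : IsManifold I 1 N := .of_le (n := ∞) (by simp)
  have h := mfderivWithin_extChartAt_symm_comp_mfderiv_extChartAt' (I := I) hx
  rw [I.range_eq_univ, mfderivWithin_univ] at h
  exact DFunLike.congr_fun h v

lemma mfderiv_chart_comp_symm {x₀ : N} {y : E} (hy : y ∈ (extChartAt I x₀).target) (v : E) :
    mfderiv I 𝓘(ℝ, E) (extChartAt I x₀) ((extChartAt I x₀).symm y)
      (mfderiv 𝓘(ℝ, E) I (extChartAt I x₀).symm y v) = v := by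
  have : IsManifold I 1 N := .of_le (n := ∞) (by simp)
  have h := mfderiv_extChartAt_comp_mfderivWithin_extChartAt_symm (I := I) hy
  rw [I.range_eq_univ, mfderivWithin_univ] at h
  exact DFunLike.congr_fun h v

variable (I I') in
/-- The expression of a map in the charts at `x₀` and `x₁`. -/
def chartRep (f : N → N') (x₀ : N) (x₁ : N') : E → E' :=
  fun y => extChartAt I' x₁ (f ((extChartAt I x₀).symm y))

variable {f : N → N'} {x₀ : N} {x₁ : N'} {y : E}

lemma contDiffAt_chartRep (hf : ContMDiff I I' ∞ f) (hy : y ∈ (extChartAt I x₀).target)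
    (hfy : f ((extChartAt I x₀).symm y) ∈ (extChartAt I' x₁).source) :
    ContDiffAt ℝ ∞ (chartRep I I' f x₀ x₁) y :=
  contMDiffAt_iff_contDiffAt.1 <|
    ContMDiffAt.comp y (contMDiffAt_chart hfy) (hf.contMDiffAt.comp y (contMDiffAt_chart_symm hy))

lemma fderiv_chartRep (hf : ContMDiff I I' ∞ f) (hy : y ∈ (extChartAt I x₀).target)
    (hfy : f ((extChartAt I x₀).symm y) ∈ (extChartAt I' x₁).source) (v : E) :
    fderiv ℝ (chartRep I I' f x₀ x₁) y v =
      mfderiv I' 𝓘(ℝ, E') (extChartAt I' x₁) (f ((extChartAt I x₀).symm y))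
        (mfderiv I I' f ((extChartAt I x₀).symm y)
          (mfderiv 𝓘(ℝ, E) I (extChartAt I x₀).symm y v)) := by
  have h1 := (contMDiffAt_chart_symm (I := I) hy).mdifferentiableAt (by simp)
  have h2 := hf.mdifferentiable (by simp) ((extChartAt I x₀).symm y)
  have h3 := (contMDiffAt_chart (I := I') hfy).mdifferentiableAt (by simp)
  rw [← mfderiv_eq_fderiv]
  have e : chartRep I I' f x₀ x₁ = extChartAt I' x₁ ∘ (f ∘ (extChartAt I x₀).symm) := rfl
  rw [e, mfderiv_comp (I' := I') y h3 (h2.comp y h1), mfderiv_comp (I' := I) y h2 h1]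
  rfl

/-- Chain rule, with the derivative of the target chart followed by that of its inverse inserted
after the derivative of f. -/
lemma inChart_pullback {n : ℕ} (σ : DiffForm I' N' n) (hf : ContMDiff I I' ∞ f)
    (hy : y ∈ (extChartAt I x₀).target)
    (hfy : f ((extChartAt I x₀).symm y) ∈ (extChartAt I' x₁).source) :
    inChart (pullback (I := I) σ f) x₀ y =
      (inChart σ x₁ (chartRep I I' f x₀ x₁ y)).compContinuousLinearMap
        (fderiv ℝ (chartRep I I' f x₀ x₁) y) := by
  rw [inChart_eq, inChart_eq]
  ext v
  refine congrArg₂ (fun z (w : Fin n → E') => (show E' [⋀^Fin n]→L[ℝ] ℝ from σ z) w)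
    ((extChartAt I' x₁).left_inv hfy).symm (funext fun i => ?_)
  refine Eq.trans ?_ (congrArg (mfderiv 𝓘(ℝ, E') I' (extChartAt I' x₁).symm
    (chartRep I I' f x₀ x₁ y)) (fderiv_chartRep hf hy hfy (v i))).symm
  exact (mfderiv_chart_symm_comp hfy _).symm

lemma eventually_mem_chart (hf : ContMDiff I I' ∞ f)
    (hy : y ∈ (extChartAt I x₀).target)
    (hfy : f ((extChartAt I x₀).symm y) ∈ (extChartAt I' x₁).source) :
    ∀ᶠ z in nhds y, z ∈ (extChartAt I x₀).target ∧
      f ((extChartAt I x₀).symm z) ∈ (extChartAt I' x₁).source := by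
  have h : ContinuousAt (fun z => f ((extChartAt I x₀).symm z)) y :=
    hf.continuous.continuousAt.comp (contMDiffAt_chart_symm hy).continuousAt
  exact ((isOpen_extChartAt_target x₀).mem_nhds hy |> Filter.Eventually.and <|
    h.eventually ((isOpen_extChartAt_source x₁).mem_nhds hfy))

lemma IsSmoothForm.contDiffAt {n : ℕ} {σ : DiffForm I N n} (hσ : IsSmoothForm σ)
    (hy : y ∈ (extChartAt I x₀).target) : ContDiffAt ℝ ∞ (inChart σ x₀) y :=
  (hσ x₀).contDiffAt ((isOpen_extChartAt_target x₀).mem_nhds hy)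

lemma IsSmoothForm.pullback {n : ℕ} {σ : DiffForm I' N' n} (hσ : IsSmoothForm σ)
    (hf : ContMDiff I I' ∞ f) : IsSmoothForm (pullback (I := I) σ f) := by
  intro x₀ y hy
  have hfy := mem_extChartAt_source (I := I') (f ((extChartAt I x₀).symm y))
  refine ContDiffAt.contDiffWithinAt ?_
  have hF := contDiffAt_chartRep hf hy hfy
  refine ContDiffAt.congr_of_eventuallyEq ?_
    ((eventually_mem_chart hf hy hfy).mono fun z hz => inChart_pullback σ hf hz.1 hz.2)
  refine ContDiffAt.compContinuousLinearMap_alternating ?_ (hF.fderiv_right (m := ∞) (by simp))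
  exact (hσ.contDiffAt ((extChartAt I' _).map_source hfy)).comp y hF

/-- The exterior derivative depends only on the germ, so naturality of d on normed spaces applies to
the local representative of f. -/
lemma extDeriv_inChart_pullback {n : ℕ} {σ : DiffForm I' N' n} (hσ : IsSmoothForm σ)
    (hf : ContMDiff I I' ∞ f) (hy : y ∈ (extChartAt I x₀).target)
    (hfy : f ((extChartAt I x₀).symm y) ∈ (extChartAt I' x₁).source) :
    extDeriv (inChart (GenCanon.pullback (I := I) σ f) x₀) y =
      (extDeriv (inChart σ x₁) (chartRep I I' f x₀ x₁ y)).compContinuousLinearMap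
        (fderiv ℝ (chartRep I I' f x₀ x₁) y) := by
  have hF := contDiffAt_chartRep hf hy hfy
  rw [Filter.EventuallyEq.extDeriv_eq
    ((eventually_mem_chart hf hy hfy).mono fun z hz => inChart_pullback σ hf hz.1 hz.2)]
  refine extDeriv_pullback (r := ∞) ?_ hF
    (by rw [minSmoothness_of_isRCLikeNormedField]; exact WithTop.coe_le_coe.2 le_top)
  exact (hσ.contDiffAt ((extChartAt I' _).map_source hfy)).differentiableAt (by simp)

lemma pullback_id {n : ℕ} (σ : DiffForm I N n) : pullback (I := I) σ (id : N → N) = σ := by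
  funext x
  rw [pullback, mfderiv_id]
  rfl

lemma fderiv_chartRep_mfderiv (hf : ContMDiff I I' ∞ f) {x : N}
    (hx : x ∈ (extChartAt I x₀).source) (hfx : f x ∈ (extChartAt I' x₁).source) (v : E) :
    fderiv ℝ (chartRep I I' f x₀ x₁) (extChartAt I x₀ x)
      (mfderiv I 𝓘(ℝ, E) (extChartAt I x₀) x v) =
    mfderiv I' 𝓘(ℝ, E') (extChartAt I' x₁) (f x) (mfderiv I I' f x v) := by
  have hl : (extChartAt I x₀).symm (extChartAt I x₀ x) = x := (extChartAt I x₀).left_inv hx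
  have hF := contDiffAt_chartRep hf ((extChartAt I x₀).map_source hx)
    (show f ((extChartAt I x₀).symm (extChartAt I x₀ x)) ∈ (extChartAt I' x₁).source by rwa [hl])
  have h1 := (contMDiffAt_chart (I := I) hx).mdifferentiableAt (by simp)
  have h2 := hf.mdifferentiable (by simp) x
  have h3 := (contMDiffAt_chart (I := I') hfx).mdifferentiableAt (by simp)
  have h4 : MDifferentiableAt 𝓘(ℝ, E) 𝓘(ℝ, E') (chartRep I I' f x₀ x₁) (extChartAt I x₀ x) :=
    (hF.differentiableAt (by simp)).mdifferentiableAt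
  have e : chartRep I I' f x₀ x₁ ∘ extChartAt I x₀ =ᶠ[nhds x] extChartAt I' x₁ ∘ f := by
    filter_upwards [(isOpen_extChartAt_source x₀).mem_nhds hx] with z hz
    simp only [chartRep, Function.comp_apply, (extChartAt I x₀).left_inv hz]
  have e' := e.mfderiv_eq (I := I) (I' := 𝓘(ℝ, E'))
  rw [mfderiv_comp (I' := 𝓘(ℝ, E)) x h4 h1, mfderiv_comp (I' := I') x h3 h2, mfderiv_eq_fderiv] at e'
  exact DFunLike.congr_fun e' v

/-- The target chart is left arbitrary: this freedom yields both chart independence of d and its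
naturality. -/
lemma extD_pullback_apply {n : ℕ} {σ : DiffForm I' N' n} (hσ : IsSmoothForm σ)
    (hf : ContMDiff I I' ∞ f) {x : N} (hfx : f x ∈ (extChartAt I' x₁).source)
    (v : Fin (n + 1) → TangentSpace I x) :
    extD (pullback (I := I) σ f) x v =
      extDeriv (inChart σ x₁) (extChartAt I' x₁ (f x)) fun i =>
        mfderiv I' 𝓘(ℝ, E') (extChartAt I' x₁) (f x) (mfderiv I I' f x (v i)) := by
  have hxx := mem_extChartAt_source (I := I) x
  have hl : (extChartAt I x).symm (extChartAt I x x) = x := extChartAt_to_inv x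
  have h := extDeriv_inChart_pullback hσ hf (mem_extChartAt_target x)
    (show f ((extChartAt I x).symm (extChartAt I x x)) ∈ (extChartAt I' x₁).source by rwa [hl])
  rw [extD_eq, h]
  have e : chartRep I I' f x x₁ (extChartAt I x x) = extChartAt I' x₁ (f x) := by
    rw [chartRep, hl]
  exact congrArg₂ (fun z (w : Fin (n + 1) → E') => extDeriv (inChart σ x₁) z w) e
    (funext fun i => fderiv_chartRep_mfderiv hf hxx hfx (v i))

/-- The exterior derivative at a point can be computed in any chart around this point. -/
lemma extD_apply {n : ℕ} {σ : DiffForm I N n} (hσ : IsSmoothForm σ) {x : N}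
    (hx : x ∈ (extChartAt I x₀).source) (v : Fin (n + 1) → TangentSpace I x) :
    extD σ x v = extDeriv (inChart σ x₀) (extChartAt I x₀ x) fun i =>
      mfderiv I 𝓘(ℝ, E) (extChartAt I x₀) x (v i) := by
  -- With f = id, the left side uses the preferred chart at x and the right side the chart at x₀.
  have h := extD_pullback_apply hσ (f := id) contMDiff_id hx v
  rw [pullback_id] at h
  rw [mfderiv_id] at h
  exact h

/-- The exterior derivative commutes with pullbacks. -/
lemma extD_pullback {n : ℕ} {σ : DiffForm I' N' n} (hσ : IsSmoothForm σ)
    (hf : ContMDiff I I' ∞ f) :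
    extD (pullback (I := I) σ f) = pullback (extD σ) f := by
  funext x
  ext v
  rw [extD_pullback_apply hσ hf (mem_extChartAt_source (f x))]
  exact (extD_apply hσ (mem_extChartAt_source (f x)) _).symm

/-- `extD` changes charts from point to point. Chart independence turns it into one formula on a
whole chart domain, which reduces smoothness of dσ and d² = 0 to normed spaces. -/
lemma inChart_extD {n : ℕ} {σ : DiffForm I N n} (hσ : IsSmoothForm σ)
    (hy : y ∈ (extChartAt I x₀).target) :
    inChart (extD σ) x₀ y = extDeriv (inChart σ x₀) y := by
  ext v
  rw [inChart_eq]
  refine (extD_apply hσ ((extChartAt I x₀).map_target hy) _).trans ?_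
  exact congrArg₂ (fun z (w : Fin (n + 1) → E) => extDeriv (inChart σ x₀) z w)
    ((extChartAt I x₀).right_inv hy) (funext fun i => mfderiv_chart_comp_symm hy (v i))

lemma IsSmoothForm.extD {n : ℕ} {σ : DiffForm I N n} (hσ : IsSmoothForm σ) :
    IsSmoothForm (extD σ) := by
  intro x₀ y hy
  refine ContDiffAt.contDiffWithinAt ?_
  refine ContDiffAt.congr_of_eventuallyEq ?_
    (Filter.mem_of_superset ((isOpen_extChartAt_target x₀).mem_nhds hy)
      fun z hz => inChart_extD hσ hz)
  have h : ContDiffAt ℝ ∞ (fderiv ℝ (inChart σ x₀)) y :=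
    (hσ.contDiffAt hy).fderiv_right (by simp)
  exact (ContinuousAlternatingMap.alternatizeUncurryFinCLM ℝ E ℝ).contDiff.contDiffAt.comp y h

lemma extD_extD {n : ℕ} {σ : DiffForm I N n} (hσ : IsSmoothForm σ) :
    GenCanon.extD (GenCanon.extD σ) = 0 := by
  funext x
  have hx := mem_extChartAt_target (I := I) x
  rw [extD_eq, Filter.EventuallyEq.extDeriv_eq (Filter.mem_of_superset
    ((isOpen_extChartAt_target x).mem_nhds hx) fun z hz => inChart_extD hσ hz),
    extDeriv_extDeriv_apply (r := ∞) (hσ.contDiffAt hx)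
      (by rw [minSmoothness_of_isRCLikeNormedField]; exact WithTop.coe_le_coe.2 le_top)]
  rfl

end Charts

/-! ### The canonical one-form in cotangent charts, and symplecticity of its derivative. -/

section CanonicalForm

variable {E : Type*} [NormedAddCommGroup E] [NormedSpace ℝ E]
  {P : Type*} [TopologicalSpace P] [ChartedSpace E P] [IsManifold 𝓘(ℝ, E) ∞ P]

lemma extChartAt_cotangent_fst (φ₀ ψ : TStar E P) :
    (extChartAt (JJ E) φ₀ ψ).1 = extChartAt 𝓘(ℝ, E) φ₀.1 ψ.1 := by
  rw [FiberBundle.extChartAt]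
  rfl

lemma extChartAt_cotangent_snd (φ₀ ψ : TStar E P) :
    (extChartAt (JJ E) φ₀ ψ).2 =
      ψ.2 ∘L (trivializationAt E (TangentSpace 𝓘(ℝ, E)) φ₀.1).symmL ℝ ψ.1 := by
  rw [FiberBundle.extChartAt]
  simp [hom_trivializationAt_apply, ContinuousLinearMap.inCoordinates]

lemma mem_source_cotangent {φ₀ ψ : TStar E P} :
    ψ ∈ (extChartAt (JJ E) φ₀).source ↔ ψ.1 ∈ (chartAt E φ₀.1).source := by
  rw [FiberBundle.extChartAt]
  simp [hom_trivializationAt_apply]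

lemma contMDiff_cotangent_proj :
    ContMDiff (JJ E) 𝓘(ℝ, E) ∞ (fun ψ : TStar E P => ψ.1) :=
  contMDiff_proj _

/-- The inverse trivialization of TP is the derivative of the inverse base chart. -/
lemma extChartAt_cotangent_snd_apply {φ₀ ψ : TStar E P} (h : ψ ∈ (extChartAt (JJ E) φ₀).source)
    (v : E) :
    (extChartAt (JJ E) φ₀ ψ).2 v =
      ψ.2 (mfderiv 𝓘(ℝ, E) 𝓘(ℝ, E) (extChartAt 𝓘(ℝ, E) φ₀.1).symm
        (extChartAt 𝓘(ℝ, E) φ₀.1 ψ.1) v) := by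
  have : IsManifold 𝓘(ℝ, E) 1 P := .of_le (n := ∞) (by simp)
  rw [extChartAt_cotangent_snd, TangentBundle.symmL_trivializationAt (mem_source_cotangent.1 h),
    (𝓘(ℝ, E)).range_eq_univ, mfderivWithin_univ]
  rfl

/-- In cotangent charts π* becomes the first projection E × E* → E; differentiate this identity. -/
lemma dproj_mfderiv_chart_symm {φ₀ : TStar E P} {y : E × (E →L[ℝ] ℝ)}
    (hy : y ∈ (extChartAt (JJ E) φ₀).target) (v : E × (E →L[ℝ] ℝ)) :
    dproj ((extChartAt (JJ E) φ₀).symm y)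
      (mfderiv 𝓘(ℝ, E × (E →L[ℝ] ℝ)) (JJ E) (extChartAt (JJ E) φ₀).symm y v) =
    mfderiv 𝓘(ℝ, E) 𝓘(ℝ, E) (extChartAt 𝓘(ℝ, E) φ₀.1).symm y.1 v.1 := by
  have e : ∀ z ∈ (extChartAt (JJ E) φ₀).target,
      z.1 = extChartAt 𝓘(ℝ, E) φ₀.1 ((extChartAt (JJ E) φ₀).symm z).1 ∧
      ((extChartAt (JJ E) φ₀).symm z).1 ∈ (extChartAt 𝓘(ℝ, E) φ₀.1).source := fun z hz => by
    have h := extChartAt_cotangent_fst φ₀ ((extChartAt (JJ E) φ₀).symm z)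
    rw [(extChartAt (JJ E) φ₀).right_inv hz] at h
    refine ⟨h, ?_⟩
    rw [extChartAt_source]
    exact mem_source_cotangent.1 ((extChartAt (JJ E) φ₀).map_target hz)
  have hy1 : y.1 ∈ (extChartAt 𝓘(ℝ, E) φ₀.1).target := by
    rw [(e y hy).1]
    exact (extChartAt 𝓘(ℝ, E) φ₀.1).map_source (e y hy).2
  have h0 : (fun ψ : TStar E P => ψ.1) ∘ (extChartAt (JJ E) φ₀).symm =ᶠ[nhds y]
      (extChartAt 𝓘(ℝ, E) φ₀.1).symm ∘ Prod.fst := by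
    filter_upwards [(isOpen_extChartAt_target φ₀).mem_nhds hy] with z hz
    obtain ⟨h1, h2⟩ := e z hz
    rw [Function.comp_apply, Function.comp_apply, h1, (extChartAt 𝓘(ℝ, E) φ₀.1).left_inv h2]
  have h1 := (contMDiffAt_chart_symm (I := JJ E) hy).mdifferentiableAt (by simp)
  have h2 := (contMDiff_cotangent_proj (E := E) (P := P)).mdifferentiable (by simp)
    ((extChartAt (JJ E) φ₀).symm y)
  have h3 := (contMDiffAt_chart_symm (I := 𝓘(ℝ, E)) hy1).mdifferentiableAt (by simp)
  have h4 : HasMFDerivAt 𝓘(ℝ, E × (E →L[ℝ] ℝ)) 𝓘(ℝ, E) Prod.fst y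
      (ContinuousLinearMap.fst ℝ E (E →L[ℝ] ℝ)) :=
    hasFDerivAt_fst.hasMFDerivAt
  have h5 := h0.mfderiv_eq (I := 𝓘(ℝ, E × (E →L[ℝ] ℝ))) (I' := 𝓘(ℝ, E))
  rw [mfderiv_comp (I' := JJ E) y h2 h1, (h3.hasMFDerivAt.comp y h4).mfderiv] at h5
  exact DFunLike.congr_fun h5 v

variable (E) in
/-- The canonical one-form `(q, η) ↦ η dq` of the model space, as a linear map. -/
def modelCanonicalForm : (E × (E →L[ℝ] ℝ)) →L[ℝ] (E × (E →L[ℝ] ℝ)) [⋀^Fin 1]→L[ℝ] ℝ :=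
  (ContinuousAlternatingMap.ofSubsingletonLIE (𝕜 := ℝ) (E := E × (E →L[ℝ] ℝ)) (F := ℝ)
      (0 : Fin 1)).toContinuousLinearEquiv.toContinuousLinearMap ∘L
    (ContinuousLinearMap.precomp ℝ (ContinuousLinearMap.fst ℝ E (E →L[ℝ] ℝ))) ∘L
    ContinuousLinearMap.snd ℝ E (E →L[ℝ] ℝ)

lemma modelCanonicalForm_apply (y : E × (E →L[ℝ] ℝ)) (v : Fin 1 → E × (E →L[ℝ] ℝ)) :
    modelCanonicalForm E y v = y.2 (v 0).1 := rfl

/-- The model form depends linearly on the point, so it is its own derivative, and d only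
antisymmetrizes it. -/
lemma extDeriv_modelCanonicalForm (y : E × (E →L[ℝ] ℝ)) (v : Fin 2 → E × (E →L[ℝ] ℝ)) :
    extDeriv (modelCanonicalForm E) y v = (v 0).2 (v 1).1 - (v 1).2 (v 0).1 := by
  rw [extDeriv, ContinuousLinearMap.fderiv,
    ContinuousAlternatingMap.alternatizeUncurryFin_apply, Fin.sum_univ_two]
  simp [modelCanonicalForm_apply, Fin.removeNth, sub_eq_add_neg]
  rfl

lemma inChart_canonicalForm {φ₀ : TStar E P} {y : E × (E →L[ℝ] ℝ)}
    (hy : y ∈ (extChartAt (JJ E) φ₀).target) :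
    inChart (toForm (canonicalForm E P)) φ₀ y = modelCanonicalForm E y := by
  ext v
  rw [inChart_eq, modelCanonicalForm_apply]
  have hs := (extChartAt (JJ E) φ₀).map_target hy
  have h2 := extChartAt_cotangent_snd_apply hs (v 0).1
  rw [← extChartAt_cotangent_fst, (extChartAt (JJ E) φ₀).right_inv hy] at h2
  rw [h2]
  exact congrArg ((extChartAt (JJ E) φ₀).symm y).2 (dproj_mfderiv_chart_symm hy (v 0))

lemma isSmoothForm_canonicalForm : IsSmoothForm (toForm (canonicalForm E P)) := fun _ =>
  (modelCanonicalForm E).contDiff.contDiffOn.congr fun _ hy => inChart_canonicalForm hy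

lemma extD_canonicalForm_apply (φ : TStar E P) (v : Fin 2 → TangentSpace (JJ E) φ) :
    extD (toForm (canonicalForm E P)) φ v =
      (mfderiv (JJ E) 𝓘(ℝ, E × (E →L[ℝ] ℝ)) (extChartAt (JJ E) φ) φ (v 0)).2
        (mfderiv (JJ E) 𝓘(ℝ, E × (E →L[ℝ] ℝ)) (extChartAt (JJ E) φ) φ (v 1)).1 -
      (mfderiv (JJ E) 𝓘(ℝ, E × (E →L[ℝ] ℝ)) (extChartAt (JJ E) φ) φ (v 1)).2
        (mfderiv (JJ E) 𝓘(ℝ, E × (E →L[ℝ] ℝ)) (extChartAt (JJ E) φ) φ (v 0)).1 := by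
  rw [extD_eq, Filter.EventuallyEq.extDeriv_eq (Filter.mem_of_superset
    ((isOpen_extChartAt_target φ).mem_nhds (mem_extChartAt_target φ))
    fun z hz => inChart_canonicalForm hz)]
  exact extDeriv_modelCanonicalForm _ _

/-- In the chart this is the duality pairing on E × E*. Testing against (0, η) kills the
E-component, as covectors separate points; testing against (u, 0) kills the E*-component. -/
lemma extD_canonicalForm_nondegenerate (φ : TStar E P) (v : TangentSpace (JJ E) φ)
    (h : ∀ w, extD (toForm (canonicalForm E P)) φ ![v, w] = 0) : v = 0 := by
  have hφ := mem_extChartAt_source (I := JJ E) φ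
  set D : E × (E →L[ℝ] ℝ) →L[ℝ] E × (E →L[ℝ] ℝ) :=
    mfderiv (JJ E) 𝓘(ℝ, E × (E →L[ℝ] ℝ)) (extChartAt (JJ E) φ) φ with hD
  have key : ∀ u : E × (E →L[ℝ] ℝ), (D v).2 u.1 - u.2 (D v).1 = 0 := fun u => by
    have hy := (extChartAt (JJ E) φ).map_source hφ
    have h1 := mfderiv_chart_comp_symm hy u
    rw [extChartAt_to_inv] at h1
    have h2 := h (mfderiv 𝓘(ℝ, E × (E →L[ℝ] ℝ)) (JJ E) (extChartAt (JJ E) φ).symm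
      (extChartAt (JJ E) φ φ) u)
    rw [extD_canonicalForm_apply] at h2
    refine Eq.trans ?_ h2
    exact congrArg (fun z : E × (E →L[ℝ] ℝ) => (D v).2 z.1 - z.2 (D v).1) h1.symm
  have e1 : (D v).1 = 0 := by
    refine SeparatingDual.eq_zero_of_forall_dual_eq_zero (R := ℝ) fun η => ?_
    simpa using key (0, η)
  have e2 : (D v).2 = 0 := by
    ext u
    simpa using key (u, 0)
  have e3 : D v = 0 := Prod.ext e1 e2
  have h4 := mfderiv_chart_symm_comp hφ v
  rw [← h4]
  exact (congrArg (mfderiv 𝓘(ℝ, E × (E →L[ℝ] ℝ)) (JJ E) (extChartAt (JJ E) φ).symm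
    (extChartAt (JJ E) φ φ)) e3).trans (ContinuousLinearMap.map_zero _)

lemma IsSymplectic.pullback_of_inverse {E' : Type*} [NormedAddCommGroup E'] [NormedSpace ℝ E']
    {H : Type*} [TopologicalSpace H] {I : ModelWithCorners ℝ E' H} [I.Boundaryless]
    {N : Type*} [TopologicalSpace N] [ChartedSpace H N] [IsManifold I ∞ N]
    {σ : DiffForm I N 2} (hσ : IsSymplectic σ) {f g : N → N} (hf : ContMDiff I I ∞ f)
    (hg : ContMDiff I I ∞ g) (hgf : ∀ x, g (f x) = x) (hfg : ∀ x, f (g x) = x) :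
    IsSymplectic (pullback (I := I) σ f) where
  smooth := hσ.smooth.pullback hf
  closed := by
    rw [extD_pullback hσ.smooth hf, hσ.closed]
    rfl
  nondegenerate x v h := by
    have hf' := fun x => hf.mdifferentiable (by simp) x
    have hg' := fun x => hg.mdifferentiable (by simp) x
    have h1 : ∀ v, mfderiv I I g (f x) (mfderiv I I f x v) = v := fun v => by
      have e : g ∘ f = id := funext hgf
      have h := mfderiv_comp (I' := I) x (hg' (f x)) (hf' x)
      rw [e, mfderiv_id] at h
      exact (DFunLike.congr_fun h v).symm
    have h2 : ∀ w, mfderiv I I f x (mfderiv I I g (f x) w) = w := fun w => by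
      have e : f ∘ g = id := funext hfg
      have h := mfderiv_comp (I' := I) (f x) (hf' (g (f x))) (hg' (f x))
      rw [e, mfderiv_id, hgf] at h
      exact (DFunLike.congr_fun h w).symm
    rw [← h1 v, hσ.nondegenerate (f x) (mfderiv I I f x v) fun w => ?_]
    · exact map_zero _
    -- Every tangent vector w at f x is the image under Tf of Tg(w), so the hypothesis at x covers
    -- all w.
    · refine Eq.trans ?_ (h (mfderiv I I g (f x) w))
      refine congrArg (σ (f x)) (funext fun i => ?_)
      fin_cases i
      · rfl
      · exact (h2 w).symm

lemma isSymplectic_canonical : IsSymplectic (extD (toForm (canonicalForm E P))) where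
  smooth := isSmoothForm_canonicalForm.extD
  closed := extD_extD isSmoothForm_canonicalForm
  nondegenerate := extD_canonicalForm_nondegenerate

end CanonicalForm

/-! ### Bundle maps read in local trivializations. -/

section InCoordinates

open ContinuousLinearMap

variable {B₁ B₂ B₃ F₁ F₂ F₃ M : Type*} {n : WithTop ℕ∞}
  {E₁ : B₁ → Type*} {E₂ : B₂ → Type*} {E₃ : B₃ → Type*}
  [TopologicalSpace B₁] [TopologicalSpace B₂] [TopologicalSpace B₃]
  [NormedAddCommGroup F₁] [NormedSpace ℝ F₁] [NormedAddCommGroup F₂] [NormedSpace ℝ F₂]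
  [NormedAddCommGroup F₃] [NormedSpace ℝ F₃]
  [∀ x, AddCommGroup (E₁ x)] [∀ x, Module ℝ (E₁ x)] [∀ x, TopologicalSpace (E₁ x)]
  [∀ x, AddCommGroup (E₂ x)] [∀ x, Module ℝ (E₂ x)] [∀ x, TopologicalSpace (E₂ x)]
  [∀ x, AddCommGroup (E₃ x)] [∀ x, Module ℝ (E₃ x)] [∀ x, TopologicalSpace (E₃ x)]
  [TopologicalSpace (TotalSpace F₁ E₁)] [TopologicalSpace (TotalSpace F₂ E₂)]
  [TopologicalSpace (TotalSpace F₃ E₃)]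
  [FiberBundle F₁ E₁] [VectorBundle ℝ F₁ E₁] [FiberBundle F₂ E₂] [VectorBundle ℝ F₂ E₂]
  [FiberBundle F₃ E₃] [VectorBundle ℝ F₃ E₃]
  {EM : Type*} [NormedAddCommGroup EM] [NormedSpace ℝ EM] {HM : Type*} [TopologicalSpace HM]
  {IM : ModelWithCorners ℝ EM HM} [TopologicalSpace M] [ChartedSpace HM M]

/-- The middle trivialization and its inverse cancel, but only over its base set. -/
lemma inCoordinates_comp {x₁ y₁ : B₁} {x₂ y₂ : B₂} {x₃ y₃ : B₃}
    (h : y₂ ∈ (trivializationAt F₂ E₂ x₂).baseSet) (ψ : E₂ y₂ →L[ℝ] E₃ y₃)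
    (ϕ : E₁ y₁ →L[ℝ] E₂ y₂) :
    inCoordinates F₁ E₁ F₃ E₃ x₁ y₁ x₃ y₃ (ψ ∘L ϕ) =
      inCoordinates F₂ E₂ F₃ E₃ x₂ y₂ x₃ y₃ ψ ∘L inCoordinates F₁ E₁ F₂ E₂ x₁ y₁ x₂ y₂ ϕ := by
  ext v
  simp [inCoordinates, h]

lemma inCoordinates_add [∀ x, IsTopologicalAddGroup (E₂ x)] {x₁ y₁ : B₁} {x₂ y₂ : B₂}
    (ψ ϕ : E₁ y₁ →L[ℝ] E₂ y₂) :
    inCoordinates F₁ E₁ F₂ E₂ x₁ y₁ x₂ y₂ (ψ + ϕ) =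
      inCoordinates F₁ E₁ F₂ E₂ x₁ y₁ x₂ y₂ ψ + inCoordinates F₁ E₁ F₂ E₂ x₁ y₁ x₂ y₂ ϕ := by
  rw [inCoordinates, add_comp, comp_add]
  rfl

lemma inCoordinates_sub [∀ x, IsTopologicalAddGroup (E₂ x)] {x₁ y₁ : B₁} {x₂ y₂ : B₂}
    (ψ ϕ : E₁ y₁ →L[ℝ] E₂ y₂) :
    inCoordinates F₁ E₁ F₂ E₂ x₁ y₁ x₂ y₂ (ψ - ϕ) =
      inCoordinates F₁ E₁ F₂ E₂ x₁ y₁ x₂ y₂ ψ - inCoordinates F₁ E₁ F₂ E₂ x₁ y₁ x₂ y₂ ϕ := by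
  rw [inCoordinates, sub_comp, comp_sub]
  rfl

lemma inCoordinates_id {x y : B₁} (h : y ∈ (trivializationAt F₁ E₁ x).baseSet) :
    inCoordinates F₁ E₁ F₁ E₁ x y x y (.id ℝ (E₁ y)) = .id ℝ F₁ := by
  ext v
  simp [inCoordinates, h]

/-- Compositions of linear maps that depend smoothly on a parameter depend smoothly on it. -/
lemma _root_.ContMDiffAt.inCoordinates_comp {b₁ : M → B₁} {b₂ : M → B₂} {b₃ : M → B₃} {m₀ : M}
    {ψ : ∀ m, E₂ (b₂ m) →L[ℝ] E₃ (b₃ m)} {ϕ : ∀ m, E₁ (b₁ m) →L[ℝ] E₂ (b₂ m)}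
    (hψ : ContMDiffAt IM 𝓘(ℝ, F₂ →L[ℝ] F₃) n
      (fun m => inCoordinates F₂ E₂ F₃ E₃ (b₂ m₀) (b₂ m) (b₃ m₀) (b₃ m) (ψ m)) m₀)
    (hϕ : ContMDiffAt IM 𝓘(ℝ, F₁ →L[ℝ] F₂) n
      (fun m => inCoordinates F₁ E₁ F₂ E₂ (b₁ m₀) (b₁ m) (b₂ m₀) (b₂ m) (ϕ m)) m₀)
    (hb : ContinuousAt b₂ m₀) :
    ContMDiffAt IM 𝓘(ℝ, F₁ →L[ℝ] F₃) n
      (fun m => inCoordinates F₁ E₁ F₃ E₃ (b₁ m₀) (b₁ m) (b₃ m₀) (b₃ m) (ψ m ∘L ϕ m)) m₀ := by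
  refine (hψ.clm_comp hϕ).congr_of_eventuallyEq ?_
  filter_upwards [hb.eventually ((trivializationAt F₂ E₂ (b₂ m₀)).open_baseSet.mem_nhds
    (FiberBundle.mem_baseSet_trivializationAt' (b₂ m₀)))] with m hm
  exact GenCanon.inCoordinates_comp hm _ _

/-- Version of `ContMDiffAt.inCoordinates_comp` for a fixed linear map on a fixed vector space. -/
lemma _root_.ContMDiffAt.inCoordinates_comp_const (b₁ : M → B₁) {c : B₂} {b₃ : M → B₃} {m₀ : M}
    {ψ : ∀ m, E₂ c →L[ℝ] E₃ (b₃ m)}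
    (hψ : ContMDiffAt IM 𝓘(ℝ, F₂ →L[ℝ] F₃) n
      (fun m => inCoordinates F₂ E₂ F₃ E₃ c c (b₃ m₀) (b₃ m) (ψ m)) m₀) (L : F₁ →L[ℝ] E₂ c) :
    ContMDiffAt IM 𝓘(ℝ, F₁ →L[ℝ] F₃) n
      (fun m => inCoordinates F₁ (Trivial B₁ F₁) F₃ E₃ (b₁ m₀) (b₁ m) (b₃ m₀) (b₃ m)
        (ψ m ∘L L)) m₀ := by
  have hL : ContMDiffAt IM 𝓘(ℝ, F₁ →L[ℝ] F₂) n
      (fun _ : M => (trivializationAt F₂ E₂ c).continuousLinearMapAt ℝ c ∘L L) m₀ :=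
    contMDiffAt_const
  refine (hψ.clm_comp hL).congr_of_eventuallyEq (.of_forall fun m => ?_)
  ext v
  simp [inCoordinates, FiberBundle.mem_baseSet_trivializationAt' c]

end InCoordinates

/-! ### The forms Θ(A) for a general A in Aut₀ TP. -/

section Smoothness

variable {E : Type*} [NormedAddCommGroup E] [NormedSpace ℝ E]
  {P : Type*} [TopologicalSpace P] [ChartedSpace E P] [IsManifold 𝓘(ℝ, E) ∞ P]
  {A : TangentEndo E P}

lemma IsAut₀.contMDiffAt_comp_proj (hA : IsAut₀ A) (φ₀ : TStar E P) :
    ContMDiffAt (JJ E) 𝓘(ℝ, E →L[ℝ] E) ∞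
      (fun φ : TStar E P => ContinuousLinearMap.inCoordinates E (TangentSpace 𝓘(ℝ, E)) E
        (TangentSpace 𝓘(ℝ, E)) φ₀.1 φ.1 φ₀.1 φ.1 (A φ.1)) φ₀ := by
  have h := hA.smooth φ₀.1
  rw [contMDiffAt_hom_bundle] at h
  exact h.2.comp φ₀ contMDiff_cotangent_proj.contMDiffAt

lemma contMDiffAt_covector (φ₀ : TStar E P) :
    ContMDiffAt (JJ E) 𝓘(ℝ, E →L[ℝ] ℝ) ∞
      (fun φ : TStar E P => ContinuousLinearMap.inCoordinates E (TangentSpace 𝓘(ℝ, E)) ℝ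
        (Trivial P ℝ) φ₀.1 φ.1 φ₀.1 φ.1 φ.2) φ₀ := by
  have h : ContMDiffAt (JJ E) (JJ E) ∞ (fun φ : TStar E P => φ) φ₀ := contMDiffAt_id
  rw [contMDiffAt_hom_bundle] at h
  exact h.2

lemma contMDiffAt_dproj (φ₀ : TStar E P) :
    ContMDiffAt (JJ E) 𝓘(ℝ, (E × (E →L[ℝ] ℝ)) →L[ℝ] E) ∞
      (fun φ : TStar E P => ContinuousLinearMap.inCoordinates (E × (E →L[ℝ] ℝ))
        (TangentSpace (JJ E)) E (TangentSpace 𝓘(ℝ, E)) φ₀ φ φ₀.1 φ.1 (dproj φ)) φ₀ := by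
  have : IsManifold 𝓘(ℝ, E) 1 P := .of_le (n := ∞) (by simp)
  have : IsManifold (JJ E) 1 (TStar E P) := .of_le (n := ∞) (by simp)
  exact ContMDiffAt.mfderiv_const (contMDiff_cotangent_proj (E := E) (P := P)).contMDiffAt
    (m := ∞) (by simp)

lemma IsAut₀.contMDiff_dual (hA : IsAut₀ A) : ContMDiff (JJ E) (JJ E) ∞ (dual A) := by
  intro φ₀
  rw [contMDiffAt_hom_bundle]
  refine ⟨contMDiff_cotangent_proj.contMDiffAt, ?_⟩
  exact (contMDiffAt_covector φ₀).inCoordinates_comp (hA.contMDiffAt_comp_proj φ₀)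
    contMDiff_cotangent_proj.continuous.continuousAt

lemma IsAut₀.isSmoothOneForm_Theta (hA : IsAut₀ A) : IsSmoothOneForm (Theta A) := by
  intro φ₀
  rw [contMDiffAt_hom_bundle]
  refine ⟨contMDiffAt_id, ?_⟩
  have hc := (contMDiff_cotangent_proj (E := E) (P := P)).continuous.continuousAt (x := φ₀)
  exact (contMDiffAt_covector φ₀).inCoordinates_comp
    ((hA.contMDiffAt_comp_proj φ₀).inCoordinates_comp (contMDiffAt_dproj φ₀) hc) hc

/-- In a cotangent chart, w lifts to the vector with base component w and fibre component 0. -/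
lemma dproj_surjective (φ : TStar E P) : Function.Surjective (dproj φ) := by
  have hy := mem_extChartAt_target (I := JJ E) φ
  intro w
  have h := dproj_mfderiv_chart_symm hy
    (mfderiv 𝓘(ℝ, E) 𝓘(ℝ, E) (extChartAt 𝓘(ℝ, E) φ.1) φ.1 w, (0 : E →L[ℝ] ℝ))
  rw [extChartAt_to_inv, extChartAt_cotangent_fst] at h
  exact ⟨_, h.trans (mfderiv_chart_symm_comp (E := E) (I := 𝓘(ℝ, E)) (mem_extChartAt_source φ.1) w)⟩

lemma Theta_mem_Can (hA : IsAut₀ A) : Theta A ∈ Can E P := by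
  refine ⟨hA.isSmoothOneForm_Theta, fun φ hφ h0 => hφ ?_, fun φ v hv => ?_, fun ξ χ hξ => ?_⟩
  -- Both A and Tπ* are onto, so Θ(A)_φ = 0 forces φ = 0.
  · ext w
    obtain ⟨u, rfl⟩ := (hA.bijective φ.1).2 w
    obtain ⟨v, rfl⟩ := dproj_surjective φ u
    exact DFunLike.congr_fun h0 v
  · simp [Theta, hv]
  -- As ξ covers χ, the function is evaluation of φ on the smooth vector field Aχ.
  · have e : (fun φ : TStar E P => Theta A φ (ξ φ)) = fun φ => φ.2 (A φ.1 (χ φ.1)) := by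
      funext φ
      simp [Theta, hξ.projects]
    rw [e]
    refine ⟨?_, fun p => ⟨fun _ _ => rfl, fun _ _ => rfl⟩⟩
    have h1 : ContMDiff (JJ E) 𝓘(ℝ, E).tangent ∞
        (fun φ : TStar E P => (⟨φ.1, A φ.1 (χ φ.1)⟩ : TangentBundle 𝓘(ℝ, E) P)) :=
      (hA.smooth.clm_bundle_apply hξ.smooth_base).comp contMDiff_cotangent_proj
    have h2 : ContMDiff (JJ E) (JJ E) ∞ (fun φ : TStar E P => φ) := contMDiff_id
    have h3 := ContMDiff.clm_bundle_apply (E₂ := Trivial P ℝ) (b := fun φ : TStar E P => φ.1)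
      (ϕ := fun φ => φ.2) h2 h1
    intro φ₀
    exact (contMDiffAt_totalSpace.1 (h3 φ₀)).2

/-- From π* ∘ A* = π*, Tπ* ∘ TA* = Tπ*; hence the pullback at φ is (φ ∘ A) ∘ Tπ*. -/
lemma pullback_dual_canonicalForm (hA : IsAut₀ A) :
    pullback (I := JJ E) (toForm (canonicalForm E P)) (dual A) = toForm (Theta A) := by
  funext φ
  ext v
  have h1 := (contMDiff_cotangent_proj (E := E) (P := P)).mdifferentiable (by simp) (dual A φ)
  have h2 := hA.contMDiff_dual.mdifferentiable (by simp) φ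
  have h := mfderiv_comp (I' := JJ E) φ h1 h2
  exact congrArg (φ.2 ∘L A φ.1) (DFunLike.congr_fun h (v 0)).symm

/-- If `A` is inverse to `A'`, then `dΘ(A)` is a symplectic form. -/
lemma isSymplectic_extD_Theta {A' : TangentEndo E P} (hA : IsAut₀ A) (hA' : IsAut₀ A')
    (h1 : ∀ p, A p ∘L A' p = .id ℝ _) (h2 : ∀ p, A' p ∘L A p = .id ℝ _) :
    IsSymplectic (extD (toForm (Theta A))) := by
  rw [← pullback_dual_canonicalForm hA, extD_pullback isSmoothForm_canonicalForm hA.contMDiff_dual]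
  refine isSymplectic_canonical.pullback_of_inverse hA.contMDiff_dual hA'.contMDiff_dual
    (fun φ => ?_) fun φ => ?_
  · exact congrArg (TotalSpace.mk φ.1)
      (by rw [dual, ContinuousLinearMap.comp_assoc, h1, ContinuousLinearMap.comp_id])
  · exact congrArg (TotalSpace.mk φ.1)
      (by rw [dual, ContinuousLinearMap.comp_assoc, h2, ContinuousLinearMap.comp_id])

end Smoothness

/-! ### Infinitesimal identities for the principal action. -/

section Principal

set_option linter.unusedSectionVars false

variable {EP EM EG : Type*} [NormedAddCommGroup EP] [NormedSpace ℝ EP]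
  [NormedAddCommGroup EM] [NormedSpace ℝ EM] [NormedAddCommGroup EG] [NormedSpace ℝ EG]
  {P M G : Type*}
  [TopologicalSpace P] [ChartedSpace EP P] [IsManifold 𝓘(ℝ, EP) ∞ P]
  [TopologicalSpace M] [ChartedSpace EM M] [IsManifold 𝓘(ℝ, EM) ∞ M]
  [TopologicalSpace G] [ChartedSpace EG G] [Group G] [LieGroup 𝓘(ℝ, EG) ∞ G]

namespace PrincipalBundle

variable (Q : PrincipalBundle EP EM EG P M G)

lemma contMDiff_orbit (p : P) : ContMDiff 𝓘(ℝ, EG) 𝓘(ℝ, EP) ∞ (fun g : G => Q.κ p g) :=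
  Q.smooth_κ.comp (contMDiff_const.prodMk contMDiff_id)

lemma contMDiff_act (g : G) : ContMDiff 𝓘(ℝ, EP) 𝓘(ℝ, EP) ∞ (fun p : P => Q.κ p g) :=
  Q.smooth_κ.comp (contMDiff_id.prodMk contMDiff_const)

lemma mfderiv_μ_dorbit (p : P) (X : GroupLieAlgebra 𝓘(ℝ, EG) G) :
    mfderiv 𝓘(ℝ, EP) 𝓘(ℝ, EM) Q.μ p (Q.dorbit p X) = 0 := by
  have h1 := (Q.contMDiff_orbit p).mdifferentiable (by simp) 1
  have h2 := Q.smooth_μ.mdifferentiable (by simp) (Q.κ p 1)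
  have h := mfderiv_comp (I' := 𝓘(ℝ, EP)) (1 : G) h2 h1
  have e : Q.μ ∘ (fun g : G => Q.κ p g) = fun _ => Q.μ p := funext fun g => Q.μ_act p g
  rw [e, mfderiv_const, Q.act_one] at h
  exact (DFunLike.congr_fun h X).symm

/-- Differentiate (ph)g = (pg)(g⁻¹hg) in h at e. -/
lemma dact_dorbit (p : P) (g : G) (X : GroupLieAlgebra 𝓘(ℝ, EG) G) :
    Q.dact g p (Q.dorbit p X) = Q.dorbit (Q.κ p g) (Ad g⁻¹ X) := by
  have h1 := (Q.contMDiff_orbit p).mdifferentiable (by simp) 1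
  have h2 := (Q.contMDiff_act g).mdifferentiable (by simp) (Q.κ p 1)
  have h3 : MDifferentiableAt 𝓘(ℝ, EG) 𝓘(ℝ, EG) (fun h : G => g⁻¹ * h * g⁻¹⁻¹) 1 :=
    (((contMDiff_const.mul contMDiff_id).mul contMDiff_const :
      ContMDiff 𝓘(ℝ, EG) 𝓘(ℝ, EG) ∞ (fun h : G => g⁻¹ * h * g⁻¹⁻¹)).mdifferentiable (by simp)) 1
  have h4 := (Q.contMDiff_orbit (Q.κ p g)).mdifferentiable (by simp) (g⁻¹ * 1 * g⁻¹⁻¹)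
  have e : (fun q : P => Q.κ q g) ∘ (fun h : G => Q.κ p h) =
      (fun h : G => Q.κ (Q.κ p g) h) ∘ fun h : G => g⁻¹ * h * g⁻¹⁻¹ := by
    funext h
    simp [← Q.act_mul, mul_assoc]
  have h5 := mfderiv_comp (I' := 𝓘(ℝ, EP)) (1 : G) h2 h1
  have h6 := mfderiv_comp (I' := 𝓘(ℝ, EG)) (1 : G) h4 h3
  rw [e, h6, Q.act_one] at h5
  have e1 : g⁻¹ * 1 * g⁻¹⁻¹ = 1 := by simp
  rw [e1] at h5
  exact (DFunLike.congr_fun h5 X).symm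

/-- The fundamental map is the partial derivative of the smooth action κ in the group variable at e.
-/
lemma contMDiffAt_dorbit (p₀ : P) :
    ContMDiffAt 𝓘(ℝ, EP) 𝓘(ℝ, EG →L[ℝ] EP) ∞
      (fun p => ContinuousLinearMap.inCoordinates EG (Trivial P EG) EP (TangentSpace 𝓘(ℝ, EP))
        p₀ p p₀ p (Q.dorbit p)) p₀ := by
  have : IsManifold 𝓘(ℝ, EP) 1 P := .of_le (n := ∞) (by simp)
  have : IsManifold 𝓘(ℝ, EG) ∞ G := inferInstance
  have : IsManifold 𝓘(ℝ, EG) 1 G := .of_le (n := ∞) (by simp)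
  have h := ContMDiffAt.mfderiv (m := ∞) Q.κ (fun _ : P => (1 : G)) (x₀ := p₀)
    Q.smooth_κ.contMDiffAt contMDiffAt_const (by simp)
  simp only [Q.act_one] at h
  -- The source of `h` is read in the trivialization of TG at e; this replaces it by the constant
  -- fibre T_eG.
  exact ContMDiffAt.inCoordinates_comp_const
    (E₂ := (TangentSpace 𝓘(ℝ, EG) : G → Type _)) (E₃ := (TangentSpace 𝓘(ℝ, EP) : P → Type _))
    (c := (1 : G)) (b₁ := fun p : P => p) (b₃ := fun p : P => p) (ψ := fun p => Q.dorbit p)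
    h (ContinuousLinearMap.id ℝ EG)

end PrincipalBundle

/-! ### The automorphism id + B attached to two connections. -/

namespace Connection

variable {Q : PrincipalBundle EP EM EG P M G} (α α' : Connection Q)

lemma idAddB_apply (p : P) (v : TangentSpace 𝓘(ℝ, EP) p) :
    α.idAddB α' p v = v + Q.dorbit p (α'.form p v - α.form p v) := rfl

lemma idAddB_comp_idAddB (p : P) :
    α.idAddB α' p ∘L α'.idAddB α p = .id ℝ _ := by
  ext v
  simp only [ContinuousLinearMap.comp_apply, idAddB_apply, map_add, map_sub, form_dorbit]
  rw [ContinuousLinearMap.id_apply]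
  abel

lemma contMDiffAt_form (p₀ : P) :
    ContMDiffAt 𝓘(ℝ, EP) 𝓘(ℝ, EP →L[ℝ] EG) ∞
      (fun p => ContinuousLinearMap.inCoordinates EP (TangentSpace 𝓘(ℝ, EP)) EG (Trivial P EG)
        p₀ p p₀ p (α.form p)) p₀ := by
  have h := α.smooth p₀
  rw [contMDiffAt_hom_bundle] at h
  exact h.2

lemma isAut₀_idAddB : IsAut₀ (α.idAddB α') where
  smooth p₀ := by
    rw [contMDiffAt_hom_bundle]
    refine ⟨contMDiffAt_id, ?_⟩
    have h2 : ContMDiffAt 𝓘(ℝ, EP) 𝓘(ℝ, EP →L[ℝ] EG) ∞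
        (fun p => ContinuousLinearMap.inCoordinates EP (TangentSpace 𝓘(ℝ, EP)) EG (Trivial P EG)
          p₀ p p₀ p (α'.form p - α.form p)) p₀ :=
      ((α'.contMDiffAt_form p₀).sub (α.contMDiffAt_form p₀)).congr_of_eventuallyEq
        (.of_forall fun p => inCoordinates_sub _ _)
    have h3 := ContMDiffAt.inCoordinates_comp (E₁ := (TangentSpace 𝓘(ℝ, EP) : P → Type _))
      (E₂ := Trivial P EG) (E₃ := (TangentSpace 𝓘(ℝ, EP) : P → Type _))
      (b₁ := fun p : P => p) (b₂ := fun p : P => p) (b₃ := fun p : P => p)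
      (ψ := fun p => Q.dorbit p) (ϕ := fun p => α'.form p - α.form p)
      (Q.contMDiffAt_dorbit p₀) h2 continuousAt_id
    have h4 : ContMDiffAt 𝓘(ℝ, EP) 𝓘(ℝ, EP →L[ℝ] EP) ∞
        (fun p => ContinuousLinearMap.id ℝ EP + ContinuousLinearMap.inCoordinates EP
          (TangentSpace 𝓘(ℝ, EP)) EP (TangentSpace 𝓘(ℝ, EP)) p₀ p p₀ p (B α α' p)) p₀ :=
      contMDiffAt_const.add h3
    refine h4.congr_of_eventuallyEq ?_
    filter_upwards [(trivializationAt EP (TangentSpace 𝓘(ℝ, EP)) p₀).open_baseSet.mem_nhds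
      (FiberBundle.mem_baseSet_trivializationAt' p₀)] with p hp
    refine (inCoordinates_add _ _).trans ?_
    rw [inCoordinates_id hp]
  bijective p := by
    refine Function.bijective_iff_has_inverse.2 ⟨α'.idAddB α p, fun v => ?_, fun v => ?_⟩
    · exact DFunLike.congr_fun (idAddB_comp_idAddB α' α p) v
    · exact DFunLike.congr_fun (idAddB_comp_idAddB α α' p) v

lemma isAutN_idAddB : Q.IsAutN (α.idAddB α') where
  isAutTG :=
    { isAut₀ := α.isAut₀_idAddB α'
      commutes := fun g X p v => by
        -- Equivariance moves Tκ_g outside on both sides; the shift by X then cancels, since both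
        -- connections return X on it.
        simp only [PrincipalBundle.Phi, idAddB_apply, form_dact, ← map_sub, ← PrincipalBundle.dact_dorbit]
        rw [← map_add, map_add (α'.form p), map_add (α.form p), form_dorbit, form_dorbit,
          add_sub_add_right_eq_sub, add_right_comm] }
  vertical p v := by
    rw [idAddB_apply, add_sub_cancel_left]
    exact Q.mfderiv_μ_dorbit p _

lemma iota_eq_Theta : α.iota α' = Theta (α.idAddB α') := by
  funext φ
  ext v
  exact (map_add φ.2 _ _).symm

lemma iota_injective : Function.Injective α.iota := by
  intro β β' h
  have key : ∀ p v, β.form p v = β'.form p v := fun p v => by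
    have h1 : ∀ η : TangentSpace 𝓘(ℝ, EP) p →L[ℝ] ℝ,
        η (α.idAddB β p v) = η (α.idAddB β' p v) := fun η => by
      rw [iota_eq_Theta, iota_eq_Theta] at h
      obtain ⟨u, hu⟩ := dproj_surjective (⟨p, η⟩ : TStar EP P) v
      have h2 := DFunLike.congr_fun (congrFun h ⟨p, η⟩) u
      simp only [Theta, ContinuousLinearMap.comp_apply, hu] at h2
      exact h2
    have h3 : α.idAddB β p v = α.idAddB β' p v := by
      exact (SeparatingDual.eq_iff_forall_dual_eq (R := ℝ) (V := EP)).2 h1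
    -- Applying β to both sides leaves 2β(v) - α(v) = β(v) + β'(v) - α(v).
    have h4 := congrArg (β.form p) h3
    simpa [idAddB_apply, form_dorbit] using h4
  obtain ⟨f, _, _, _⟩ := β
  obtain ⟨f', _, _, _⟩ := β'
  obtain rfl : f = f' := funext fun p => ContinuousLinearMap.ext (key p)
  rfl

end Connection

end Principal

end GenCanon

end

theorem corollary7
    {EP EM EG : Type*}
    [NormedAddCommGroup EP] [NormedSpace ℝ EP] [FiniteDimensional ℝ EP]
    [NormedAddCommGroup EM] [NormedSpace ℝ EM] [FiniteDimensional ℝ EM]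
    [NormedAddCommGroup EG] [NormedSpace ℝ EG] [FiniteDimensional ℝ EG]
    {P M G : Type*}
    [TopologicalSpace P] [ChartedSpace EP P] [IsManifold 𝓘(ℝ, EP) ∞ P]
    [TopologicalSpace M] [ChartedSpace EM M] [IsManifold 𝓘(ℝ, EM) ∞ M]
    [TopologicalSpace G] [ChartedSpace EG G] [Group G] [LieGroup 𝓘(ℝ, EG) ∞ G]
    (Q : GenCanon.PrincipalBundle EP EM EG P M G) (α : GenCanon.Connection Q) :
    (∀ α' : GenCanon.Connection Q,
      α.iota α' ∈ GenCanon.Can EP P ∧ α.iota α' ∈ Q.CanTG) ∧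
    Function.Injective α.iota ∧
    (∀ α' : GenCanon.Connection Q,
      Q.IsAutN (α.idAddB α') ∧
      ContMDiff (GenCanon.JJ EP) (GenCanon.JJ EP) ∞ (GenCanon.dual (α.idAddB α')) ∧
      GenCanon.IsSymplectic (GenCanon.extD (GenCanon.toForm (α.iota α'))) ∧
      GenCanon.extD (GenCanon.toForm (α.iota α')) =
        GenCanon.pullback (GenCanon.extD (GenCanon.toForm (GenCanon.canonicalForm EP P)))
          (GenCanon.dual (α.idAddB α'))) := by
  refine ⟨fun α' => ?_, α.iota_injective, fun α' => ?_⟩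
  · rw [α.iota_eq_Theta α']
    exact ⟨GenCanon.Theta_mem_Can (α.isAut₀_idAddB α'), _, (α.isAutN_idAddB α').isAutTG, rfl⟩
  · have hA := α.isAut₀_idAddB α'
    refine ⟨α.isAutN_idAddB α', hA.contMDiff_dual, ?_⟩
    rw [α.iota_eq_Theta α']
    refine ⟨GenCanon.isSymplectic_extD_Theta hA (α'.isAut₀_idAddB α)
      (α.idAddB_comp_idAddB α') (α'.idAddB_comp_idAddB α), ?_⟩
    rw [← GenCanon.extD_pullback GenCanon.isSmoothForm_canonicalForm hA.contMDiff_dual,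
      GenCanon.pullback_dual_canonicalForm hA]
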